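/- Let $\mathbb{N}=\{1,2,3,\dots\}$. For a finite poset $P$, define the formal power series \[ \Gamma^{<}(P,\boldsymbol{x})=\sum_{f}\prod_{v\in P}x_{f(v)},\qquad \Gamma^{\le}(P,\boldsymbol{x})=\sum_{g}\prod_{v\in P}x_{g(v)} \] in $\mathbb{Z}[[x_1,x_2,\dots]]$, where $f$ runs over all maps $P\to\mathbb{N}$ such that $u<v$ implies $f(u)<f(v)$, and $g$ runs over all maps $P\to\mathbb{N}$ such that $u<v$ implies $g(u)\le g(v)$. Let $\mathsf{N}$ be the poset on four elements $a,b,c,d$ whose only strict relations are $a<b$, $c<b$, $c<d$, and let $\Join$ be the poset on $a,b,c,d$ whose only strict relations are $a<b$, $c<b$, $c<d$, $a<d$. A poset is $(\mathsf{N},\Join)$-free if no subset of it, with the induced order, is isomorphic to $\mathsf{N}$ or to $\Join$. Theorem. Let $P$ and $Q$ be finite $(\mathsf{N},\Join)$-free posets. Then the following are equivalent: (1) $\Gamma^{<}(P,\boldsymbol{x})=\Gamma^{<}(Q,\boldsymbol{x})$; (2) $\Gamma^{\le}(P,\boldsymbol{x})=\Gamma^{\le}(Q,\boldsymbol{x})$;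 (3) $P$ and $Q$ are isomorphic as posets. -/

import Mathlib

/-- The four-element poset `N`, with the strict relations `a < b`, `c < b`, `c < d` and no
others. -/
inductive PosetN : Type
  | a
  | b
  | c
  | d
  deriving DecidableEq

/-- The four-element poset `⋈`, with the strict relations `a < b`, `c < b`, `c < d`, `a < d` and
no others. -/
inductive PosetBowtie : Type
  | a
  | b
  | c
  | d
  deriving DecidableEq

instance : PartialOrder PosetN where
  le x y := x = y ∨ (x = .a ∧ y = .b) ∨ (x = .c ∧ y = .b) ∨ (x = .c ∧ y = .d)
  le_refl x := Or.inl rfl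
  le_trans x y z := by cases x <;> cases y <;> cases z <;> decide
  le_antisymm x y := by cases x <;> cases y <;> decide

instance : PartialOrder PosetBowtie where
  le x y := x = y ∨ (x = .a ∧ y = .b) ∨ (x = .c ∧ y = .b) ∨ (x = .c ∧ y = .d) ∨
    (x = .a ∧ y = .d)
  le_refl x := Or.inl rfl
  le_trans x y z := by cases x <;> cases y <;> cases z <;> decide
  le_antisymm x y := by cases x <;> cases y <;> decide

/-- A poset is `(N, ⋈)`-free if no subset with the induced order is isomorphic to `N` or to `⋈`,
that is, neither `N` nor `⋈` has an order embedding (`x ≤ y ↔ f x ≤ f y`) into it. -/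
def IsNBowtieFree (P : Type*) [PartialOrder P] : Prop :=
  IsEmpty (PosetN ↪o P) ∧ IsEmpty (PosetBowtie ↪o P)

/-- Only finitely many maps `f : P → {1, 2, …}` contribute to a given monomial `x ^ m`. -/
theorem finite_support_coeff_prod_X (P : Type*) [Fintype P] (m : ℕ+ →₀ ℕ) :
    (Function.support fun f : P → ℕ+ =>
      MvPowerSeries.coeff m (∏ v, MvPowerSeries.X (f v) : MvPowerSeries ℕ+ ℤ)).Finite := by
  classical
  refine (Set.Finite.pi' (fun _ : P => m.support.finite_toSet)).subset fun f hf v => ?_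
  have h : (∏ v, MvPowerSeries.X (f v) : MvPowerSeries ℕ+ ℤ) =
      ((MvPolynomial.monomial (∑ v, Finsupp.single (f v) 1) (1 : ℤ) : MvPolynomial ℕ+ ℤ) :
        MvPowerSeries ℕ+ ℤ) := by
    rw [MvPolynomial.monomial_sum_one, ← MvPolynomial.coeToMvPowerSeries.ringHom_apply, map_prod]
    refine Finset.prod_congr rfl fun v _ => ?_
    rw [MvPolynomial.coeToMvPowerSeries.ringHom_apply, MvPolynomial.coe_monomial, MvPowerSeries.X]
  rw [Function.mem_support, h, MvPolynomial.coeff_coe, MvPolynomial.coeff_monomial] at hf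
  have hm : ∑ v, Finsupp.single (f v) 1 = m := by
    by_contra hne
    exact hf (if_neg hne)
  rw [Finset.mem_coe, Finsupp.mem_support_iff, ← hm, Finsupp.finsetSum_apply]
  intro h0
  have := (Finset.sum_eq_zero_iff.mp h0) v (Finset.mem_univ v)
  simp at this

/-- The formal power series `∑_{f ∈ S} ∏_{v ∈ P} x_{f(v)}` in the variables `x₁, x₂, …`, where `S`
is a set of maps from `P` to the positive integers. The formal sum is taken coefficientwise; by
`finite_support_coeff_prod_X` every coefficient is a sum with finitely many non-zero terms. -/
noncomputable def formalSum {P : Type*} [Fintype P] (S : Set (P → ℕ+)) : MvPowerSeries ℕ+ ℤ :=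
  fun m => ∑ᶠ f ∈ S, MvPowerSeries.coeff m (∏ v, MvPowerSeries.X (f v) : MvPowerSeries ℕ+ ℤ)

/-- The strict order quasisymmetric function `Γ^<(P, x)`: the sum is over the maps `f` such that
`u < v` implies `f u < f v`. -/
noncomputable def strictOrderQSym (P : Type*) [Fintype P] [PartialOrder P] :
    MvPowerSeries ℕ+ ℤ :=
  formalSum {f : P → ℕ+ | ∀ u v, u < v → f u < f v}

/-- The weak order quasisymmetric function `Γ^≤(P, x)`: the sum is over the maps `f` such that
`u < v` implies `f u ≤ f v`. -/
noncomputable def weakOrderQSym (P : Type*) [Fintype P] [PartialOrder P] :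
    MvPowerSeries ℕ+ ℤ :=
  formalSum {f : P → ℕ+ | ∀ u v, u < v → f u ≤ f v}

/-! ### Decomposition of (N, ⋈)-free posets. -/

section Structure

/-! A nonempty poset in this class has a connected component with a least or a greatest element, and
deleting that element leaves a poset in the class (`IsNBowtieFree.exists_decomposition`).
Reconstruction therefore reduces to recognising one component from the generating function and then
stripping its extremal element.

Truncate to `m` variables, where the strict generating function is an integer polynomial and the
ring is a UFD. Disjoint sums become products. With a least element adjoined to `P`, the polynomial
is linear in the first variable, with constant term again that of `WithBot P` and linear coefficient
that of `P`, both in one variable fewer (`finSuccEquiv_strictPoly_withBot`). It is irreducible for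
large `m` once the two coefficients have no common nonunit factor. To see that they have none, the
induction carries the auxiliary property `FirstVarGeneric` for the poset and its dual
(`isUnit_of_dvd_strictPoly_withBot`, `IsNBowtieFree.generic`). Unique factorization then matches a
component of `P` with a piece of `Q`, cancellation handles the remainder, and the linear coefficient
recovers the component without its least element (`IsNBowtieFree.nonempty_orderIso`).

Weak equality implies strict equality for all finite posets. Labels are declared strict or weak
individually, and a sign-reversing involution expresses counts with a strict label through counts
with fewer elements at strict labels (`sum_admissibleCount_eq_zero`, `admissibleCount_eq_of_weak`).
-/

theorem IsNBowtieFree.of_orderEmbedding {P Q : Type*} [PartialOrder P] [PartialOrder Q]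
    (hQ : IsNBowtieFree Q) (e : P ↪o Q) : IsNBowtieFree P :=
  ⟨⟨fun f => hQ.1.false (f.trans e)⟩, ⟨fun f => hQ.2.false (f.trans e)⟩⟩

theorem PosetN.le_iff (x y : PosetN) : x ≤ y ↔
    x = y ∨ (x = .a ∧ y = .b) ∨ (x = .c ∧ y = .b) ∨ (x = .c ∧ y = .d) := Iff.rfl

theorem PosetBowtie.le_iff (x y : PosetBowtie) : x ≤ y ↔
    x = y ∨ (x = .a ∧ y = .b) ∨ (x = .c ∧ y = .b) ∨ (x = .c ∧ y = .d) ∨ (x = .a ∧ y = .d) :=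
  Iff.rfl

/-- The reversal of the path `a < b > c < d`. -/
def PosetN.toDual : PosetN ↪o PosetNᵒᵈ :=
  OrderEmbedding.ofMapLEIff
    (fun x => OrderDual.toDual (match x with | .a => .d | .b => .c | .c => .b | .d => .a))
    (by intro x y; cases x <;> cases y <;> simp [PosetN.le_iff])

/-- The bowtie is self-dual. -/
def PosetBowtie.toDual : PosetBowtie ↪o PosetBowtieᵒᵈ :=
  OrderEmbedding.ofMapLEIff
    (fun x => OrderDual.toDual (match x with | .a => .d | .b => .c | .c => .b | .d => .a))
    (by intro x y; cases x <;> cases y <;> simp [PosetBowtie.le_iff])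

theorem IsNBowtieFree.dual {P : Type*} [PartialOrder P] (h : IsNBowtieFree P) :
    IsNBowtieFree Pᵒᵈ :=
  ⟨⟨fun f => h.1.false (PosetN.toDual.trans f.dual)⟩,
    ⟨fun f => h.2.false (PosetBowtie.toDual.trans f.dual)⟩⟩

/-- In an `(N, ⋈)`-free poset, a zigzag `a ≤ b ≥ c ≤ d` of minimal and maximal elements is
degenerate. -/
theorem IsNBowtieFree.eq_or_eq_of_zigzag {P : Type*} [PartialOrder P] (h : IsNBowtieFree P)
    {a b c d : P} (ha : IsMin a) (hb : IsMax b) (hc : IsMin c) (hd : IsMax d)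
    (hab : a ≤ b) (hcb : c ≤ b) (hcd : c ≤ d) : a = c ∨ b = d := by
  by_contra! hne
  obtain ⟨hac, hbd⟩ := hne
  have h1 : ¬ a ≤ c := fun h => hac (hc.eq_of_le h)
  have h2 : ¬ c ≤ a := fun h => hac (ha.eq_of_le h).symm
  have h3 : ¬ b ≤ d := fun h => hbd (hb.eq_of_ge h).symm
  have h4 : ¬ d ≤ b := fun h => hbd (hd.eq_of_ge h)
  have h5 : ¬ b ≤ a := fun h => h2 (hcb.trans h)
  have h6 : ¬ b ≤ c := fun h => h1 (hab.trans h)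
  have h7 : ¬ d ≤ c := fun h => h4 (h.trans hcb)
  have h8 : ¬ d ≤ a := fun h => h4 (h.trans hab)
  by_cases had : a ≤ d
  · refine h.2.false (OrderEmbedding.ofMapLEIff
      (fun x : PosetBowtie => match x with | .a => a | .b => b | .c => c | .d => d) ?_)
    intro x y; cases x <;> cases y <;> simp [PosetBowtie.le_iff, *]
  · refine h.1.false (OrderEmbedding.ofMapLEIff
      (fun x : PosetN => match x with | .a => a | .b => b | .c => c | .d => d) ?_)
    intro x y; cases x <;> cases y <;> simp [PosetN.le_iff, *]

theorem exists_isMin_le {P : Type*} [PartialOrder P] [Finite P] (x : P) :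
    ∃ a ≤ x, IsMin a := by
  obtain ⟨a, hax, ha⟩ := (Set.finite_univ (α := P)).exists_le_minimal (Set.mem_univ x)
  exact ⟨a, hax, fun b hb => ha.2 (Set.mem_univ b) hb⟩

theorem exists_le_isMax {P : Type*} [PartialOrder P] [Finite P] (x : P) :
    ∃ b, x ≤ b ∧ IsMax b :=
  exists_isMin_le (P := Pᵒᵈ) x

/-- A non-empty finite `(N, ⋈)`-free poset has a connected component with a least or a greatest
element. -/
theorem IsNBowtieFree.exists_component {P : Type*} [PartialOrder P] [Finite P] [Nonempty P]
    (h : IsNBowtieFree P) : ∃ S : Set P, IsLowerSet S ∧ IsUpperSet S ∧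
      ((∃ a, IsLeast S a) ∨ ∃ b, IsGreatest S b) := by
  obtain ⟨a, -, ha⟩ := exists_isMin_le (Classical.arbitrary P)
  -- If two maximal elements lie above `a`, zigzags through `a` force every minimal element reached
  -- to be `a`, so the up-set of `a` splits off. Otherwise the down-set of the unique maximal
  -- element above `a` splits off.
  by_cases hu : ∃ b d, IsMax b ∧ IsMax d ∧ a ≤ b ∧ a ≤ d ∧ b ≠ d
  · obtain ⟨b, d, hb, hd, hab, had, hbd⟩ := hu
    refine ⟨Set.Ici a, ?_, isUpperSet_Ici a, Or.inl ⟨a, isLeast_Ici⟩⟩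
    intro x y hyx hax
    obtain ⟨a', hay, ha'⟩ := exists_isMin_le y
    obtain ⟨b', hxb, hb'⟩ := exists_le_isMax x
    -- A maximal element above `a` other than `b'` keeps the zigzag `a' ≤ b' ≥ a ≤ d'` from
    -- degenerating at the top, so it must degenerate at the bottom.
    obtain ⟨d', hd', had', hne⟩ : ∃ d', IsMax d' ∧ a ≤ d' ∧ b' ≠ d' := by
      by_cases hb'b : b' = b
      · exact ⟨d, hd, had, hb'b ▸ hbd⟩
      · exact ⟨b, hb, hab, hb'b⟩
    rcases h.eq_or_eq_of_zigzag ha' hb' ha hd' (hay.trans (hyx.trans hxb)) (le_trans hax hxb) had'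
      with e | e
    · exact e ▸ hay
    · exact absurd e hne
  · obtain ⟨b, hab, hb⟩ := exists_le_isMax a
    refine ⟨Set.Iic b, isLowerSet_Iic b, ?_, Or.inr ⟨b, isGreatest_Iic⟩⟩
    intro x y hxy hxb
    obtain ⟨a', hax, ha'⟩ := exists_isMin_le x
    obtain ⟨b', hyb, hb'⟩ := exists_le_isMax y
    rcases h.eq_or_eq_of_zigzag ha hb ha' hb' hab (hax.trans hxb) (hax.trans (hxy.trans hyb))
      with e | e
    · by_cases hbb : b = b'
      · exact hbb ▸ hyb
      · exact absurd ⟨b, b', hb, hb', hab, e ▸ hax.trans (hxy.trans hyb), hbb⟩ hu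
    · exact e ▸ hyb

/-- A subset that is closed upwards and downwards splits off as a summand. -/
noncomputable def sumComplOrderIso {P : Type*} [PartialOrder P] (S : Set P) (hl : IsLowerSet S)
    (hu : IsUpperSet S) : (S ⊕ (Sᶜ : Set P)) ≃o P :=
  haveI := Classical.decPred (· ∈ S)
  { Equiv.Set.sumCompl S with
    map_rel_iff' := by
      rintro (⟨x, hx⟩ | ⟨x, hx⟩) (⟨y, hy⟩ | ⟨y, hy⟩)
      · simp
      · simpa using fun hxy => hy (hu hxy hx)
      · simpa using fun hxy => hx (hl hxy hy)
      · simp }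

/-- A poset with a least element arises by adjoining it to a smaller poset. -/
theorem exists_withBot_orderIso {T : Type*} [PartialOrder T] {a : T} (ha : ∀ x, a ≤ x) :
    Nonempty (WithBot {x : T // x ≠ a} ≃o T) := by
  classical
  let _ : OrderBot T := { bot := a, bot_le := ha }
  exact ⟨WithBot.subtypeOrderIso⟩

theorem card_withBot (K : Type*) [Fintype K] : Fintype.card (WithBot K) = Fintype.card K + 1 :=
  (Fintype.card_congr (β := Option K) (Equiv.refl _)).trans Fintype.card_option

universe u

/-- A non-empty finite `(N, ⋈)`-free poset is a disjoint sum of a smaller such poset and a poset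
obtained by adjoining a least or a greatest element to a smaller such poset. -/
theorem IsNBowtieFree.exists_decomposition {P : Type u} [PartialOrder P] [Fintype P] [Nonempty P]
    (h : IsNBowtieFree P) : ∃ (K R : Type u) (_ : PartialOrder K) (_ : PartialOrder R)
      (_ : Fintype K) (_ : Fintype R), IsNBowtieFree K ∧ IsNBowtieFree R ∧
      Fintype.card P = Fintype.card K + 1 + Fintype.card R ∧
      (Nonempty (WithBot K ⊕ R ≃o P) ∨ Nonempty ((WithBot K)ᵒᵈ ⊕ R ≃o P)) := by
  classical
  obtain ⟨S, hl, hu, hS⟩ := h.exists_component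
  have hR : IsNBowtieFree (Sᶜ : Set P) := h.of_orderEmbedding (OrderEmbedding.subtype _)
  have hSf : IsNBowtieFree S := h.of_orderEmbedding (OrderEmbedding.subtype _)
  let e := sumComplOrderIso S hl hu
  have hc : Fintype.card P = Fintype.card S + Fintype.card (Sᶜ : Set P) := by
    rw [← Fintype.card_sum, Fintype.card_congr e.toEquiv]
  rcases hS with ⟨a, haS, ha⟩ | ⟨a, haS, ha⟩
  · obtain ⟨f⟩ := exists_withBot_orderIso (T := S) (a := ⟨a, haS⟩) fun x => ha x.2
    refine ⟨{x : S // x ≠ ⟨a, haS⟩}, (Sᶜ : Set P), inferInstance, inferInstance, inferInstance,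
      inferInstance, hSf.of_orderEmbedding (OrderEmbedding.subtype _), hR, ?_,
      Or.inl ⟨(OrderIso.sumCongr f (OrderIso.refl _)).trans e⟩⟩
    rw [hc, ← Fintype.card_congr f.toEquiv, card_withBot]
  · obtain ⟨f⟩ := exists_withBot_orderIso (T := Sᵒᵈ) (a := OrderDual.toDual ⟨a, haS⟩)
      fun x => ha x.2
    refine ⟨{x : Sᵒᵈ // x ≠ OrderDual.toDual ⟨a, haS⟩}, (Sᶜ : Set P), inferInstance, inferInstance,
      inferInstance, inferInstance, hSf.dual.of_orderEmbedding (OrderEmbedding.subtype _), hR, ?_,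
      Or.inr ⟨(OrderIso.sumCongr (f.dual.trans (OrderIso.dualDual S).symm) (OrderIso.refl _)).trans e⟩⟩
    rw [hc, ← card_withBot, Fintype.card_congr f.toEquiv, Fintype.card_orderDual]

end Structure

/-! ### Strict generating polynomials in finitely many variables. -/

section StrictPoly

open MvPolynomial

open Classical in
/-- The strict order quasisymmetric function in `m` variables, as a polynomial. -/
noncomputable def strictPoly (m : ℕ) (P : Type*) [Fintype P] [PartialOrder P] :
    MvPolynomial (Fin m) ℤ :=
  ∑ f : {f : P → Fin m // StrictMono f}, ∏ v, X (f.1 v)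

variable {P Q : Type*} [Fintype P] [PartialOrder P] [Fintype Q] [PartialOrder Q]

theorem strictPoly_eq (m : ℕ) (P : Type*) [Fintype P] [PartialOrder P]
    [Fintype {f : P → Fin m // StrictMono f}] :
    strictPoly m P = ∑ f : {f : P → Fin m // StrictMono f}, ∏ v, X (f.1 v) := by
  rw [strictPoly]
  congr!

theorem strictPoly_congr (e : P ≃o Q) (m : ℕ) : strictPoly m P = strictPoly m Q := by
  classical
  rw [strictPoly_eq, strictPoly_eq]
  refine Fintype.sum_equiv (Equiv.subtypeEquiv (e.toEquiv.arrowCongr (Equiv.refl (Fin m)))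
    fun f => ⟨fun hf => hf.comp e.symm.strictMono, fun hf => ?_⟩) _ _ fun f => ?_
  · have := hf.comp e.strictMono
    convert this using 1
    ext v
    simp
  · refine Fintype.prod_equiv e.toEquiv _ _ fun v => ?_
    simp

theorem strictPoly_sum (m : ℕ) : strictPoly m (P ⊕ Q) = strictPoly m P * strictPoly m Q := by
  classical
  rw [strictPoly_eq, strictPoly_eq, strictPoly_eq, Fintype.sum_mul_sum, ← Fintype.sum_prod_type']
  have hsum (g : {f : P → Fin m // StrictMono f}) (h : {f : Q → Fin m // StrictMono f}) :
      StrictMono (Sum.elim g.1 h.1) := by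
    rintro (a | a) (b | b) hab
    · exact g.2 (Sum.inl_lt_inl_iff.1 hab)
    · exact absurd hab Sum.not_inl_lt_inr
    · exact absurd hab Sum.not_inr_lt_inl
    · exact h.2 (Sum.inr_lt_inr_iff.1 hab)
  refine Fintype.sum_equiv
    { toFun f := (⟨f.1 ∘ Sum.inl, f.2.comp Sum.inl_strictMono⟩,
        ⟨f.1 ∘ Sum.inr, f.2.comp Sum.inr_strictMono⟩)
      invFun g := ⟨Sum.elim g.1.1 g.2.1, hsum _ _⟩
      left_inv f := Subtype.ext (Sum.elim_comp_inl_inr f.1) } _ _ fun f => ?_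
  exact Fintype.prod_sum_type _

theorem strictPoly_dual (m : ℕ) :
    strictPoly m Pᵒᵈ = rename Fin.rev (strictPoly m P) := by
  classical
  rw [strictPoly_eq, strictPoly_eq, map_sum]
  refine Fintype.sum_equiv
    { toFun f := ⟨fun v => Fin.rev (f.1 (OrderDual.toDual v)),
        fun a b h => Fin.rev_lt_rev.2 (f.2 (OrderDual.toDual_lt_toDual.2 h))⟩
      invFun f := ⟨fun v => Fin.rev (f.1 (OrderDual.ofDual v)),
        fun a b h => Fin.rev_lt_rev.2 (f.2 (OrderDual.ofDual_lt_ofDual.2 h))⟩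
      left_inv f := by ext; simp
      right_inv f := by ext; simp } _ _ fun f => ?_
  · rw [map_prod]
    exact Fintype.prod_equiv OrderDual.ofDual _ _ fun v => by simp

theorem strictPoly_isHomogeneous (m : ℕ) : (strictPoly m P).IsHomogeneous (Fintype.card P) := by
  classical
  rw [strictPoly_eq]
  refine IsHomogeneous.sum _ _ _ fun f _ => ?_
  have := IsHomogeneous.prod Finset.univ (fun v => (X (f.1 v) : MvPolynomial (Fin m) ℤ))
    (fun _ => 1) fun v _ => isHomogeneous_X _ _
  simpa using this

/-- Label each element by the number of elements strictly below it. -/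
theorem exists_strictMono_fin {m : ℕ} (h : Fintype.card P ≤ m) :
    ∃ f : P → Fin m, StrictMono f ∧ ∀ v, IsMin v → (f v : ℕ) = 0 := by
  classical
  have hlt (v : P) : (Finset.univ.filter (· < v)).card < m :=
    (Finset.card_lt_univ_of_notMem (x := v) (by simp)).trans_le h
  refine ⟨fun v => ⟨_, hlt v⟩, fun a b hab => ?_, fun v hv => ?_⟩
  · rw [Fin.mk_lt_mk]
    refine Finset.card_lt_card ⟨fun x hx => ?_, fun hs => ?_⟩
    · simpa using (Finset.mem_filter.1 hx).2.trans hab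
    · simpa using hs (Finset.mem_filter.2 ⟨Finset.mem_univ a, hab⟩)
  · simpa [Finset.filter_eq_empty_iff] using fun x => hv.not_lt

/-- The value at the all-ones point counts strict labellings. Its positivity gives nonvanishing and
later excludes the unit `-1`. -/
theorem eval_one_strictPoly (m : ℕ) :
    0 ≤ eval (fun _ => 1) (strictPoly m P) ∧
      (Fintype.card P ≤ m → 0 < eval (fun _ => 1) (strictPoly m P)) := by
  classical
  have : eval (fun _ => 1) (strictPoly m P) =
      (Fintype.card {f : P → Fin m // StrictMono f} : ℤ) := by
    simp [strictPoly_eq, map_sum, map_prod]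
  rw [this]
  refine ⟨Int.natCast_nonneg _, fun h => ?_⟩
  obtain ⟨f, hf, -⟩ := exists_strictMono_fin h
  exact Int.natCast_pos.2 (Fintype.card_pos_iff.2 ⟨⟨f, hf⟩⟩)

theorem strictPoly_ne_zero {m : ℕ} (h : Fintype.card P ≤ m) : strictPoly m P ≠ 0 := by
  intro h0
  simpa [h0] using (eval_one_strictPoly (P := P) m).2 h

theorem totalDegree_strictPoly {m : ℕ} (h : Fintype.card P ≤ m) :
    (strictPoly m P).totalDegree = Fintype.card P :=
  (strictPoly_isHomogeneous m).totalDegree (strictPoly_ne_zero h)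

theorem coeff_strictPoly (m : ℕ) (d : Fin m →₀ ℕ) : (strictPoly m P).coeff d =
    ({f : P → Fin m | StrictMono f ∧ ∑ v, Finsupp.single (f v) 1 = d}.ncard : ℤ) := by
  classical
  have key (f : P → Fin m) : (∏ v, X (f v) : MvPolynomial (Fin m) ℤ) =
      monomial (∑ v, Finsupp.single (f v) 1) 1 := by
    rw [monomial_sum_one]; rfl
  rw [strictPoly_eq, coeff_sum]
  simp_rw [key, coeff_monomial]
  rw [Finset.sum_boole, Set.ncard_eq_toFinset_card', Set.toFinset_card, ← Fintype.card_subtype,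
    Fintype.card_congr (Equiv.subtypeSubtypeEquivSubtypeInter _
      fun f : P → Fin m => ∑ v, Finsupp.single (f v) 1 = d)]
  rfl

/-- Some strict labelling gives every minimal element the label `0`, and its monomial survives
because coefficients are counts. This bounds the number of minimal elements. -/
theorem card_isMin_le_degreeOf_strictPoly {m : ℕ} (h : Fintype.card P ≤ m + 1) (s : Finset P)
    (hs : ∀ v ∈ s, IsMin v) : s.card ≤ degreeOf 0 (strictPoly (m + 1) P) := by
  classical
  obtain ⟨f, hf, hmin⟩ := exists_strictMono_fin h
  have hsupp : (∑ v, Finsupp.single (f v) 1) ∈ (strictPoly (m + 1) P).support := by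
    rw [mem_support_iff, coeff_strictPoly]
    exact Nat.cast_ne_zero.2 (Set.ncard_ne_zero_of_mem (a := f) ⟨hf, rfl⟩)
  refine le_trans ?_ (monomial_le_degreeOf 0 hsupp)
  rw [Finsupp.finsetSum_apply]
  calc s.card = ∑ v ∈ s, (Finsupp.single (f v) 1 : Fin (m + 1) →₀ ℕ) 0 := by
        rw [Finset.card_eq_sum_ones]
        refine Finset.sum_congr rfl fun v hv => ?_
        have : f v = 0 := Fin.ext (hmin v (hs v hv))
        simp [this]
    _ ≤ _ := Finset.sum_le_sum_of_subset (Finset.subset_univ s)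

/-- Setting the first variable to zero. -/
noncomputable def dropVar (m : ℕ) : MvPolynomial (Fin (m + 1)) ℤ →+* MvPolynomial (Fin m) ℤ :=
  Polynomial.constantCoeff.comp (finSuccEquiv ℤ m : _ →+* _)

theorem dropVar_apply {m : ℕ} (p : MvPolynomial (Fin (m + 1)) ℤ) :
    dropVar m p = (finSuccEquiv ℤ m p).coeff 0 := rfl

/-- Labellings that use the label `0` are killed, and the others are shifts of labellings with one
label fewer. Hence equalities and divisibilities descend from many variables to few. -/
theorem dropVar_strictPoly (m : ℕ) : dropVar m (strictPoly (m + 1) P) = strictPoly m P := by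
  classical
  rw [strictPoly_eq, strictPoly_eq, map_sum]
  symm
  refine Fintype.sum_of_injective
    (fun f => ⟨Fin.succ ∘ f.1, (Fin.strictMono_succ).comp f.2⟩) ?_ _ _ ?_ ?_
  · intro f g hfg
    ext v : 2
    exact Fin.succ_injective _ (congrFun (congrArg Subtype.val hfg) v)
  · intro f hf
    by_cases h : ∃ v, f.1 v = 0
    · obtain ⟨v, hv⟩ := h
      rw [map_prod]
      refine Finset.prod_eq_zero (Finset.mem_univ v) ?_
      rw [hv, dropVar_apply, finSuccEquiv_X_zero, Polynomial.coeff_X_zero]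
    · push Not at h
      refine absurd ⟨⟨fun v => (f.1 v).pred (h v), fun a b hab => ?_⟩, ?_⟩ hf
      · exact Fin.pred_lt_pred_iff.2 (f.2 hab)
      · ext; simp
  · intro f
    rw [map_prod]
    refine Finset.prod_congr rfl fun v _ => ?_
    simp only [Function.comp, dropVar_apply]
    rw [finSuccEquiv_X_succ, Polynomial.coeff_C_zero]

/-- Only the bottom can carry the label `0`, since every other element lies strictly above it. The
two summands correspond to whether it does. -/
theorem finSuccEquiv_strictPoly_withBot (m : ℕ) :
    finSuccEquiv ℤ m (strictPoly (m + 1) (WithBot P)) =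
      Polynomial.C (strictPoly m (WithBot P)) + Polynomial.X * Polynomial.C (strictPoly m P) := by
  classical
  let F : {f : WithBot P → Fin m // StrictMono f} ⊕ {f : P → Fin m // StrictMono f} →
      {f : WithBot P → Fin (m + 1) // StrictMono f} :=
    Sum.elim (fun f => ⟨Fin.succ ∘ f.1, (Fin.strictMono_succ).comp f.2⟩)
      (fun f => ⟨WithBot.recBotCoe 0 (fun v => (f.1 v).succ), by
        intro a b hab
        induction b with
        | bot => simp at hab
        | coe b =>
          induction a with
          | bot => simp
          | coe a => simpa using f.2 (WithBot.coe_lt_coe.1 hab)⟩)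
  have hF : Function.Bijective F := by
    constructor
    · rintro (f | f) (g | g) hfg
      · congr 1
        ext v : 2
        exact Fin.succ_injective _ (congrFun (congrArg Subtype.val hfg) v)
      · exact absurd (congrFun (congrArg Subtype.val hfg) ⊥) (Fin.succ_ne_zero _)
      · exact absurd (congrFun (congrArg Subtype.val hfg) ⊥).symm (Fin.succ_ne_zero _)
      · congr 1
        ext v : 2
        exact Fin.succ_injective _ (congrFun (congrArg Subtype.val hfg) v)
    · intro f
      have hpos (v : P) : f.1 v ≠ 0 := fun h => by
        have := f.2 (WithBot.bot_lt_coe v)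
        rw [h] at this
        exact absurd this (Fin.not_lt_zero _)
      by_cases h0 : f.1 ⊥ = 0
      · refine ⟨Sum.inr ⟨fun v => (f.1 v).pred (hpos v), fun a b hab => ?_⟩, ?_⟩
        · exact Fin.pred_lt_pred_iff.2 (f.2 (WithBot.coe_lt_coe.2 hab))
        · ext v : 2
          induction v with
          | bot => exact h0.symm
          | coe v => simp [F]
      · have hne (v : WithBot P) : f.1 v ≠ 0 := by
          induction v with
          | bot => exact h0
          | coe v => exact hpos v
        refine ⟨Sum.inl ⟨fun v => (f.1 v).pred (hne v), fun a b hab => ?_⟩, ?_⟩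
        · exact Fin.pred_lt_pred_iff.2 (f.2 hab)
        · ext v : 2
          simp [F]
  have hprod {M : Type} [CommMonoid M] (g : WithBot P → M) :
      ∏ v, g v = g ⊥ * ∏ v : P, g v := by
    have := Fintype.prod_option (f := fun v : Option P => g v)
    refine Eq.trans ?_ this
    exact Fintype.prod_equiv (Equiv.refl _) _ _ fun _ => rfl
  rw [strictPoly_eq, strictPoly_eq, strictPoly_eq, map_sum,
    ← hF.sum_comp fun f => finSuccEquiv ℤ m (∏ v, X (f.1 v)), Fintype.sum_sum_type, map_sum,
    map_sum, Finset.mul_sum]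
  congr 1
  · refine Finset.sum_congr rfl fun f _ => ?_
    rw [map_prod, map_prod]
    exact Finset.prod_congr rfl fun v _ => finSuccEquiv_X_succ
  · refine Finset.sum_congr rfl fun f _ => ?_
    rw [hprod, map_mul, map_prod, map_prod]
    congr 1
    · exact finSuccEquiv_X_zero
    · exact Finset.prod_congr rfl fun v _ => finSuccEquiv_X_succ

end StrictPoly

/-! ### Irreducibility of the polynomial of a poset with a least element. -/

section Irreducible

open MvPolynomial Filter

theorem eventually_add_iff {p : ℕ → Prop} (k : ℕ) :
    (∀ᶠ m in atTop, p (m + k)) ↔ ∀ᶠ m in atTop, p m := by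
  conv_rhs => rw [← map_add_atTop_eq_nat k, eventually_map]

/-- Every divisor of `p` that does not involve the first variable is a unit. -/
def FirstVarGeneric {m : ℕ} (p : MvPolynomial (Fin (m + 1)) ℤ) : Prop :=
  ∀ d, d ∣ p → degreeOf 0 d = 0 → IsUnit d

theorem finSuccEquiv_eq_C_dropVar {m : ℕ} {d : MvPolynomial (Fin (m + 1)) ℤ}
    (h : degreeOf 0 d = 0) : finSuccEquiv ℤ m d = Polynomial.C (dropVar m d) :=
  Polynomial.eq_C_of_natDegree_eq_zero (by rw [natDegree_finSuccEquiv, h])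

theorem totalDegree_eq_zero_of_isUnit {σ : Type*} {d : MvPolynomial σ ℤ} (h : IsUnit d) :
    d.totalDegree = 0 := by
  obtain ⟨r, -, rfl⟩ := isUnit_iff_eq_C_of_isReduced.1 h
  exact totalDegree_C r

/-- A nonunit divisor free of the first variable has an irreducible factor free of it, and this
factor, being prime, divides `p` or `q`. -/
theorem FirstVarGeneric.mul {m : ℕ} {p q : MvPolynomial (Fin (m + 1)) ℤ} (hp : FirstVarGeneric p)
    (hq : FirstVarGeneric q) (h0 : p * q ≠ 0) : FirstVarGeneric (p * q) := by
  intro d hd hd0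
  by_contra hu
  have hdne : d ≠ 0 := ne_zero_of_dvd_ne_zero h0 hd
  obtain ⟨r, hr, c, rfl⟩ := WfDvdMonoid.exists_irreducible_factor hu hdne
  have hr0 : degreeOf 0 r = 0 := by
    rw [degreeOf_mul_eq (left_ne_zero_of_mul hdne) (right_ne_zero_of_mul hdne)] at hd0
    lia
  rcases hr.prime.dvd_or_dvd ((dvd_mul_right r c).trans hd) with h | h
  · exact hr.not_isUnit (hp r h hr0)
  · exact hr.not_isUnit (hq r h hr0)

theorem FirstVarGeneric.of_irreducible {m : ℕ} {p : MvPolynomial (Fin (m + 1)) ℤ}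
    (hp : Irreducible p) (h : degreeOf 0 p ≠ 0) : FirstVarGeneric p := by
  rintro d ⟨c, rfl⟩ hd
  refine (hp.isUnit_or_isUnit rfl).resolve_right fun hc => h ?_
  obtain ⟨r, -, rfl⟩ := isUnit_iff_eq_C_of_isReduced.1 hc
  exact Nat.le_zero.1 ((degreeOf_mul_C_le _ _ _).trans hd.le)

variable {P Q : Type*} [Fintype P] [PartialOrder P] [Fintype Q] [PartialOrder Q]

theorem degreeOf_strictPoly_withBot {m : ℕ} (h : Fintype.card P ≤ m) :
    degreeOf 0 (strictPoly (m + 1) (WithBot P)) = 1 := by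
  have := strictPoly_ne_zero h
  rw [← natDegree_finSuccEquiv, finSuccEquiv_strictPoly_withBot]
  compute_degree!

/-- A common divisor of the two coefficients of the polynomial of `WithBot P`, as a polynomial in
the first variable, is a unit. -/
theorem isUnit_of_dvd_strictPoly_withBot {m : ℕ} (hm : Fintype.card P ≤ m)
    (h1 : FirstVarGeneric (strictPoly (m + 1) P)) (h2 : FirstVarGeneric (strictPoly (m + 2) P))
    {f : MvPolynomial (Fin (m + 2)) ℤ} (hf : f ∣ strictPoly (m + 2) (WithBot P))
    (hf' : f ∣ strictPoly (m + 2) P) : IsUnit f := by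
  by_contra hu
  have hf0 : degreeOf 0 f ≠ 0 := fun h => hu (h2 f hf' h)
  have hcard : Fintype.card (WithBot P) = Fintype.card P + 1 := card_withBot P
  obtain ⟨g, hg⟩ := hf
  have hne : f * g ≠ 0 := hg ▸ strictPoly_ne_zero (by lia)
  have hdeg := degreeOf_mul_eq (n := 0) (left_ne_zero_of_mul hne) (right_ne_zero_of_mul hne)
  rw [← hg, degreeOf_strictPoly_withBot (by lia)] at hdeg
  have hg0 : degreeOf 0 g = 0 := by lia
  -- As `f` has degree one in the first variable, its cofactor `g` is the constant `q`. Comparing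
  -- coefficients, `q` divides the polynomial of `P` in `m + 1` variables, and so does the constant
  -- term of `f`.
  set q := dropVar _ g
  have hA : strictPoly (m + 1) (WithBot P) = dropVar _ f * q := by
    rw [← map_mul, ← hg, dropVar_strictPoly]
  have hB : q ∣ strictPoly (m + 1) P := by
    have := congrArg (finSuccEquiv ℤ (m + 1)) hg
    rw [map_mul, finSuccEquiv_eq_C_dropVar hg0, finSuccEquiv_strictPoly_withBot] at this
    have := congrArg (Polynomial.coeff · 1) this
    simp only [Polynomial.coeff_add, Polynomial.coeff_C_succ, Polynomial.coeff_mul_C,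
      Polynomial.coeff_X_one, one_mul, zero_add] at this
    exact Dvd.intro_left _ this.symm
  have hA' : dropVar _ f ∣ strictPoly (m + 1) P := by
    rw [← dropVar_strictPoly]
    exact map_dvd _ hf'
  have hne' : dropVar _ f * q ≠ 0 := hA ▸ strictPoly_ne_zero (by lia)
  have hPne : strictPoly (m + 1) P ≠ 0 := strictPoly_ne_zero (by lia)
  have htot := totalDegree_mul_of_isDomain (left_ne_zero_of_mul hne') (right_ne_zero_of_mul hne')
  rw [← hA, totalDegree_strictPoly (by lia), hcard] at htot
  have hq := totalDegree_le_of_dvd_of_isDomain hB hPne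
  have hA'' := totalDegree_le_of_dvd_of_isDomain hA' hPne
  rw [totalDegree_strictPoly (by lia)] at hq hA''
  -- The total degrees of `dropVar _ f` and `q` add up to `card P + 1` while each is at most `card
  -- P`, so neither is a unit. By genericity both involve the new first variable, but their product
  -- has degree only one in it.
  have hA0 : degreeOf 0 (dropVar _ f) ≠ 0 := fun h => by
    have := totalDegree_eq_zero_of_isUnit (h1 _ hA' h)
    lia
  have hdeg' := degreeOf_mul_eq (n := 0) (left_ne_zero_of_mul hne') (right_ne_zero_of_mul hne')
  rw [← hA, degreeOf_strictPoly_withBot (by lia)] at hdeg'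
  have := totalDegree_eq_zero_of_isUnit (h1 q hB (by lia))
  lia

/-- In a factorization of a polynomial linear in the first variable, one factor is free of that
variable. It divides both coefficients, hence is a unit. -/
theorem irreducible_strictPoly_withBot_of_generic {m : ℕ} (hm : Fintype.card P ≤ m)
    (h1 : FirstVarGeneric (strictPoly (m + 1) P)) (h2 : FirstVarGeneric (strictPoly (m + 2) P)) :
    Irreducible (strictPoly (m + 3) (WithBot P)) := by
  have hcard : Fintype.card (WithBot P) = Fintype.card P + 1 := card_withBot P
  have key (a : MvPolynomial (Fin (m + 3)) ℤ) (ha : a ∣ strictPoly (m + 3) (WithBot P))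
      (ha0 : degreeOf 0 a = 0) : IsUnit a := by
    have hdvd := map_dvd (finSuccEquiv ℤ (m + 2)) ha
    rw [finSuccEquiv_strictPoly_withBot, finSuccEquiv_eq_C_dropVar ha0,
      Polynomial.C_dvd_iff_dvd_coeff] at hdvd
    have hu := isUnit_of_dvd_strictPoly_withBot hm h1 h2 (by simpa using hdvd 0)
      (by simpa using hdvd 1)
    rw [← MulEquiv.isUnit_map (finSuccEquiv ℤ (m + 2)), finSuccEquiv_eq_C_dropVar ha0]
    exact hu.map Polynomial.C
  refine ⟨fun hu => ?_, fun a b hab => ?_⟩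
  · have := totalDegree_eq_zero_of_isUnit hu
    rw [totalDegree_strictPoly (by lia)] at this
    lia
  · have hne : a * b ≠ 0 := hab ▸ strictPoly_ne_zero (by lia)
    have hdeg := degreeOf_mul_eq (n := 0) (left_ne_zero_of_mul hne) (right_ne_zero_of_mul hne)
    rw [← hab, degreeOf_strictPoly_withBot (by lia)] at hdeg
    rcases Nat.eq_zero_or_pos (degreeOf 0 a) with h | h
    · exact Or.inl (key a (hab ▸ dvd_mul_right a b) h)
    · exact Or.inr (key b (hab ▸ dvd_mul_left b a) (by lia))

theorem irreducible_strictPoly_withBot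
    (h : ∀ᶠ m in atTop, FirstVarGeneric (strictPoly (m + 1) P)) :
    ∀ᶠ m in atTop, Irreducible (strictPoly m (WithBot P)) := by
  rw [← eventually_add_iff 3]
  filter_upwards [h, (eventually_add_iff (p := fun m => FirstVarGeneric (strictPoly (m + 1) P)) 1).2 h,
    eventually_ge_atTop (Fintype.card P)] with m h1 h2 hm
  exact irreducible_strictPoly_withBot_of_generic hm h1 h2

theorem irreducible_strictPoly_dual_iff {m : ℕ} :
    Irreducible (strictPoly m Pᵒᵈ) ↔ Irreducible (strictPoly m P) := by
  rw [strictPoly_dual]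
  exact MulEquiv.irreducible_iff (renameEquiv ℤ Fin.revPerm)

theorem strictPoly_of_isEmpty [IsEmpty P] (m : ℕ) : strictPoly m P = 1 := by
  classical
  simp [strictPoly_eq, Fintype.card_subtype, Subsingleton.strictMono]

/-- An irreducible polynomial here belongs to a nonempty poset, whose minimal elements can be
labelled `0`, so the first variable occurs. -/
theorem generic_of_irreducible (h : ∀ᶠ m in atTop, Irreducible (strictPoly m P)) :
    ∀ᶠ m in atTop, FirstVarGeneric (strictPoly (m + 1) P) := by
  filter_upwards [(eventually_add_iff 1).2 h, eventually_ge_atTop (Fintype.card P)] with m hm hc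
  refine .of_irreducible hm fun h0 => ?_
  have : Nonempty P := by
    by_contra hP
    rw [not_nonempty_iff] at hP
    exact hm.not_isUnit (strictPoly_of_isEmpty (P := P) (m + 1) ▸ isUnit_one)
  obtain ⟨a, -, ha⟩ := exists_isMin_le (Classical.arbitrary P)
  have := card_isMin_le_degreeOf_strictPoly (m := m) (by lia) {a} (by simpa using ha)
  rw [h0] at this
  simp at this

theorem generic_sum (hP : ∀ᶠ m in atTop, FirstVarGeneric (strictPoly (m + 1) P))
    (hQ : ∀ᶠ m in atTop, FirstVarGeneric (strictPoly (m + 1) Q)) :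
    ∀ᶠ m in atTop, FirstVarGeneric (strictPoly (m + 1) (P ⊕ Q)) := by
  filter_upwards [hP, hQ, eventually_ge_atTop (Fintype.card P),
    eventually_ge_atTop (Fintype.card Q)] with m h1 h2 h3 h4
  rw [strictPoly_sum]
  exact h1.mul h2 (mul_ne_zero (strictPoly_ne_zero (by lia)) (strictPoly_ne_zero (by lia)))

/-- `(a + b)ᵒᵈ` is the sum of the duals. -/
def sumDualOrderIso (A B : Type*) [PartialOrder A] [PartialOrder B] :
    (A ⊕ B)ᵒᵈ ≃o Aᵒᵈ ⊕ Bᵒᵈ :=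
  { toFun x := Sum.map OrderDual.toDual OrderDual.toDual (OrderDual.ofDual x)
    invFun x := OrderDual.toDual (Sum.map OrderDual.ofDual OrderDual.ofDual x)
    left_inv x := by cases x using OrderDual.rec with | _ x => cases x <;> rfl
    right_inv x := by cases x <;> rfl
    map_rel_iff' := by
      intro x y
      cases x using OrderDual.rec with | _ x =>
      cases y using OrderDual.rec with | _ y =>
      cases x <;> cases y <;> simp }

universe u

/-- Duality reverses the variables, so genericity in the first variable does not pass directly to
the dual, and the induction carries both. Irreducibility is insensitive to the reversal, which
handles the component with an extremal element. -/
theorem IsNBowtieFree.generic (n : ℕ) : ∀ (P : Type u) [Fintype P] [PartialOrder P],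
    IsNBowtieFree P → Fintype.card P = n →
    (∀ᶠ m in atTop, FirstVarGeneric (strictPoly (m + 1) P)) ∧
      ∀ᶠ m in atTop, FirstVarGeneric (strictPoly (m + 1) Pᵒᵈ) := by
  induction n using Nat.strong_induction_on with
  | _ n ih =>
  intro P _ _ hP hn
  cases isEmpty_or_nonempty P with
  | inl h =>
    have h1 (m : ℕ) : FirstVarGeneric (1 : MvPolynomial (Fin (m + 1)) ℤ) :=
      fun d hd _ => isUnit_of_dvd_one hd
    have : IsEmpty Pᵒᵈ := h
    simp_rw [strictPoly_of_isEmpty]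
    exact ⟨.of_forall h1, .of_forall h1⟩
  | inr h =>
    obtain ⟨K, R, _, _, _, _, hK, hR, hc, e⟩ := hP.exists_decomposition
    have hKirr := irreducible_strictPoly_withBot (ih _ (by lia) K hK rfl).1
    have hKirr' : ∀ᶠ m in atTop, Irreducible (strictPoly m (WithBot K)ᵒᵈ) := by
      simpa only [irreducible_strictPoly_dual_iff] using hKirr
    obtain ⟨hR1, hR2⟩ := ih _ (by lia) R hR rfl
    have hK1 := generic_of_irreducible hKirr
    have hK2 := generic_of_irreducible hKirr'
    rcases e with ⟨⟨e⟩⟩ | ⟨⟨e⟩⟩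
    · have e2 : Pᵒᵈ ≃o (WithBot K)ᵒᵈ ⊕ Rᵒᵈ := e.dual.symm.trans (sumDualOrderIso _ _)
      simp_rw [← strictPoly_congr e, strictPoly_congr e2]
      exact ⟨generic_sum hK1 hR1, generic_sum hK2 hR2⟩
    · have e2 : Pᵒᵈ ≃o (WithBot K)ᵒᵈᵒᵈ ⊕ Rᵒᵈ := e.dual.symm.trans (sumDualOrderIso _ _)
      simp_rw [← strictPoly_congr e, strictPoly_congr e2]
      refine ⟨generic_sum hK2 hR1, generic_sum ?_ hR2⟩
      simpa only [strictPoly_congr (OrderIso.dualDual (WithBot K)).symm] using hK1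

end Irreducible

/-! ### Recovering the poset by unique factorization. -/

section Reconstruction

open MvPolynomial Filter

theorem forall_of_frequently {p : ℕ → Prop} (hp : ∀ m, p (m + 1) → p m)
    (h : ∃ᶠ m in atTop, p m) (m : ℕ) : p m := by
  obtain ⟨b, hb, hpb⟩ := frequently_atTop.1 h m
  obtain ⟨k, rfl⟩ := Nat.exists_eq_add_of_le hb
  induction k with
  | zero => exact hpb
  | succ k ih => exact ih (Nat.le_add_right _ _) (hp _ hpb)

universe u v

section

variable {P : Type u} {Q : Type v} [Fintype P] [PartialOrder P] [Fintype Q] [PartialOrder Q]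

theorem strictPoly_eq_of_frequently (h : ∃ᶠ m in atTop, strictPoly m P = strictPoly m Q) (m : ℕ) :
    strictPoly m P = strictPoly m Q :=
  forall_of_frequently (p := fun m => strictPoly m P = strictPoly m Q)
    (fun m hm => by rw [← dropVar_strictPoly, hm, dropVar_strictPoly]) h m

theorem strictPoly_dvd_of_frequently (h : ∃ᶠ m in atTop, strictPoly m P ∣ strictPoly m Q) (m : ℕ) :
    strictPoly m P ∣ strictPoly m Q :=
  forall_of_frequently (p := fun m => strictPoly m P ∣ strictPoly m Q)
    (fun m hm => by
      rw [← dropVar_strictPoly, ← dropVar_strictPoly (P := Q)]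
      exact map_dvd _ hm) h m

/-- The units are `1` and `-1`, and the values at the all-ones point settle the sign. -/
theorem strictPoly_eq_of_associated {m : ℕ} (hm : Fintype.card P ≤ m)
    (h : Associated (strictPoly m P) (strictPoly m Q)) : strictPoly m P = strictPoly m Q := by
  obtain ⟨⟨w, w', hw, hw'⟩, h⟩ := h
  obtain ⟨r, hr, rfl⟩ := isUnit_iff_eq_C_of_isReduced.1 (IsUnit.of_mul_eq_one w' hw)
  rcases Int.isUnit_iff.1 hr with rfl | rfl
  · simpa using h
  · have h1 := (eval_one_strictPoly (P := P) m).2 hm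
    have h2 := (eval_one_strictPoly (P := Q) m).1
    rw [← h] at h2
    simp only [map_mul, eval_C] at h2
    lia

theorem strictPoly_eq_of_dvd (hP : ∀ᶠ m in atTop, Irreducible (strictPoly m P))
    (hQ : ∀ᶠ m in atTop, Irreducible (strictPoly m Q))
    (h : ∀ m, strictPoly m P ∣ strictPoly m Q) (m : ℕ) : strictPoly m P = strictPoly m Q := by
  refine strictPoly_eq_of_frequently (Eventually.frequently ?_) m
  filter_upwards [hP, hQ, eventually_ge_atTop (Fintype.card P)] with m h1 h2 h3
  exact strictPoly_eq_of_associated h3 (h1.associated_of_dvd h2 (h m))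

theorem card_eq_of_strictPoly_eq (h : ∀ m, strictPoly m P = strictPoly m Q) :
    Fintype.card P = Fintype.card Q := by
  rw [← totalDegree_strictPoly (le_max_left _ (Fintype.card Q)), h,
    totalDegree_strictPoly (le_max_right _ _)]

end

theorem IsNBowtieFree.irreducible_withBot {P : Type u} [Fintype P] [PartialOrder P]
    (hP : IsNBowtieFree P) : ∀ᶠ m in atTop, Irreducible (strictPoly m (WithBot P)) :=
  irreducible_strictPoly_withBot (IsNBowtieFree.generic _ P hP rfl).1

theorem IsNBowtieFree.exists_irreducible_component {P : Type u} [Fintype P] [PartialOrder P]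
    [Nonempty P] (hP : IsNBowtieFree P) : ∃ (K T R : Type u) (_ : PartialOrder K)
      (_ : PartialOrder T) (_ : PartialOrder R) (_ : Fintype K) (_ : Fintype T) (_ : Fintype R),
      IsNBowtieFree K ∧ IsNBowtieFree T ∧ IsNBowtieFree R ∧
      (∀ᶠ m in atTop, Irreducible (strictPoly m T)) ∧
      (Nonempty (WithBot K ≃o T) ∨ Nonempty (WithBot K ≃o Tᵒᵈ)) ∧
      Fintype.card P = Fintype.card T + Fintype.card R ∧ Nonempty (T ⊕ R ≃o P) := by
  obtain ⟨K, R, _, _, _, _, hK, hR, hc, ⟨⟨e⟩⟩ | ⟨⟨e⟩⟩⟩ := hP.exists_decomposition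
  · refine ⟨K, WithBot K, R, inferInstance, inferInstance, inferInstance, inferInstance,
      inferInstance, inferInstance, hK, ?_, hR, hK.irreducible_withBot, Or.inl ⟨OrderIso.refl _⟩,
      by rw [hc, card_withBot], ⟨e⟩⟩
    exact hP.of_orderEmbedding
      ((OrderEmbedding.ofMapLEIff Sum.inl fun _ _ => Sum.inl_le_inl_iff).trans e.toOrderEmbedding)
  · refine ⟨K, (WithBot K)ᵒᵈ, R, inferInstance, inferInstance, inferInstance, inferInstance,
      inferInstance, inferInstance, hK, ?_, hR, ?_, Or.inr ⟨OrderIso.dualDual _⟩,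
      by rw [hc, Fintype.card_orderDual, card_withBot], ⟨e⟩⟩
    · exact hP.of_orderEmbedding
        ((OrderEmbedding.ofMapLEIff Sum.inl fun _ _ => Sum.inl_le_inl_iff).trans e.toOrderEmbedding)
    · simpa only [irreducible_strictPoly_dual_iff] using hK.irreducible_withBot

/-- A poset with irreducible polynomials that divide those of `Q` shares its polynomials with a
component of `Q`. -/
theorem IsNBowtieFree.exists_component_of_dvd {K : Type u} [Fintype K] [PartialOrder K]
    (hK : ∀ᶠ m in atTop, Irreducible (strictPoly m K)) (n : ℕ) :
    ∀ (Q : Type v) [Fintype Q] [PartialOrder Q], IsNBowtieFree Q → Fintype.card Q = n →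
      (∀ m, strictPoly m K ∣ strictPoly m Q) →
      ∃ (T R : Type v) (_ : PartialOrder T) (_ : PartialOrder R) (_ : Fintype T) (_ : Fintype R),
        IsNBowtieFree T ∧ IsNBowtieFree R ∧ (∀ m, strictPoly m K = strictPoly m T) ∧
        Nonempty (T ⊕ R ≃o Q) := by
  induction n using Nat.strong_induction_on with
  | _ n ih =>
  intro Q _ _ hQ hn hdvd
  cases isEmpty_or_nonempty Q with
  | inl h =>
    obtain ⟨m, hm⟩ := hK.exists
    exact absurd (isUnit_of_dvd_one (strictPoly_of_isEmpty (P := Q) m ▸ hdvd m)) hm.not_isUnit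
  | inr h =>
    obtain ⟨L, T, R, _, _, _, _, _, _, -, hT, hR, hirr, hL, hc, ⟨e⟩⟩ :=
      hQ.exists_irreducible_component
    have hTpos : 0 < Fintype.card T := by
      rcases hL with ⟨⟨f⟩⟩ | ⟨⟨f⟩⟩
      · exact Fintype.card_pos_iff.2 ⟨f ⊥⟩
      · exact Fintype.card_pos_iff.2 ⟨OrderDual.ofDual (f ⊥)⟩
    -- Which factor is divisible may depend on `m`, but one alternative occurs for arbitrarily large
    -- `m` and then descends to every `m`.
    have hor : ∃ᶠ m in atTop, strictPoly m K ∣ strictPoly m T ∨ strictPoly m K ∣ strictPoly m R := by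
      refine Eventually.frequently ?_
      filter_upwards [hK] with m hm
      refine hm.prime.dvd_or_dvd ?_
      rw [← strictPoly_sum, strictPoly_congr e]
      exact hdvd m
    rcases frequently_or_distrib.1 hor with h | h
    · exact ⟨T, R, inferInstance, inferInstance, inferInstance, inferInstance, hT, hR,
        strictPoly_eq_of_dvd hK hirr (strictPoly_dvd_of_frequently h), ⟨e⟩⟩
    · obtain ⟨T', R', _, _, _, _, hT', hR', heq, ⟨e'⟩⟩ :=
        ih _ (by lia) R hR rfl (strictPoly_dvd_of_frequently h)
      let e₂ : T' ⊕ (R' ⊕ T) ≃o Q :=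
        (OrderIso.sumAssoc _ _ _).symm.trans ((OrderIso.sumCongr e' (OrderIso.refl _)).trans
          ((OrderIso.sumComm _ _).trans e))
      refine ⟨T', R' ⊕ T, inferInstance, inferInstance, inferInstance, inferInstance, hT', ?_,
        heq, ⟨e₂⟩⟩
      exact hQ.of_orderEmbedding
        ((OrderEmbedding.ofMapLEIff Sum.inr fun _ _ => Sum.inr_le_inr_iff).trans
          e₂.toOrderEmbedding)

/-- The polynomials of a poset detect a least element. -/
theorem exists_withBot_of_strictPoly_eq {K : Type u} [Fintype K] [PartialOrder K] {T : Type v}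
    [Fintype T] [PartialOrder T] (h : ∀ m, strictPoly m (WithBot K) = strictPoly m T) :
    ∃ a : T, Nonempty (WithBot {x : T // x ≠ a} ≃o T) := by
  classical
  have hc := card_eq_of_strictPoly_eq h
  have hcK := card_withBot K
  have : Nonempty T := Fintype.card_pos_iff.1 (by lia)
  obtain ⟨a, -, ha⟩ := exists_isMin_le (Classical.arbitrary T)
  refine ⟨a, exists_withBot_orderIso fun x => ?_⟩
  obtain ⟨b, hbx, hb⟩ := exists_isMin_le x
  rcases eq_or_ne a b with rfl | hab
  · exact hbx
  · have := card_isMin_le_degreeOf_strictPoly (P := T) (m := Fintype.card K) (by lia) {a, b}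
      (by simp [ha, hb])
    rw [← h, degreeOf_strictPoly_withBot le_rfl, Finset.card_pair hab] at this
    lia

/-- Compare the linear coefficients in the first variable. -/
theorem strictPoly_eq_of_withBot {K : Type u} [Fintype K] [PartialOrder K] {L : Type v}
    [Fintype L] [PartialOrder L] (h : ∀ m, strictPoly m (WithBot K) = strictPoly m (WithBot L))
    (m : ℕ) : strictPoly m K = strictPoly m L := by
  have := congrArg (fun p => (finSuccEquiv ℤ m p).coeff 1) (h (m + 1))
  simpa [finSuccEquiv_strictPoly_withBot] using this

/-- A finite `(N, ⋈)`-free poset is determined by its strict order polynomials in finitely many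
variables. -/
theorem IsNBowtieFree.nonempty_orderIso (n : ℕ) : ∀ (P : Type u) (Q : Type v) [Fintype P]
    [PartialOrder P] [Fintype Q] [PartialOrder Q], IsNBowtieFree P → IsNBowtieFree Q →
    Fintype.card P = n → (∀ m, strictPoly m P = strictPoly m Q) → Nonempty (P ≃o Q) := by
  induction n using Nat.strong_induction_on with
  | _ n ih =>
  intro P Q _ _ _ _ hP hQ hn h
  have hcard := card_eq_of_strictPoly_eq h
  cases isEmpty_or_nonempty P with
  | inl hE =>
    have : IsEmpty Q := Fintype.card_eq_zero_iff.1 (by rw [← hcard, Fintype.card_eq_zero])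
    exact ⟨⟨Equiv.equivOfIsEmpty P Q, fun {a} => isEmptyElim a⟩⟩
  | inr hN =>
    obtain ⟨K, T, R, _, _, _, _, _, _, hK, hT, hR, hirr, hKT, hc, ⟨e⟩⟩ :=
      hP.exists_irreducible_component
    obtain ⟨T', R', _, _, _, _, hT', hR', hTT', ⟨e'⟩⟩ :=
      IsNBowtieFree.exists_component_of_dvd hirr _ Q hQ rfl fun m => by
        rw [← h, ← strictPoly_congr e, strictPoly_sum]
        exact dvd_mul_right _ _
    have hcT : Fintype.card T = Fintype.card K + 1 := by
      rcases hKT with ⟨⟨f⟩⟩ | ⟨⟨f⟩⟩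
      · rw [← Fintype.card_congr f.toEquiv, card_withBot]
      · rw [← Fintype.card_orderDual, ← Fintype.card_congr f.toEquiv, card_withBot]
    have hRR' : ∀ m, strictPoly m R = strictPoly m R' := by
      refine strictPoly_eq_of_frequently (Eventually.frequently ?_)
      -- Cancelling `strictPoly m T` requires it to be nonzero, hence enough variables. Equality
      -- then descends to all `m`.
      filter_upwards [eventually_ge_atTop (Fintype.card T)] with m hm
      have := h m
      rw [← strictPoly_congr e, ← strictPoly_congr e', strictPoly_sum, strictPoly_sum,
        ← hTT'] at this
      exact mul_left_cancel₀ (strictPoly_ne_zero hm) this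
    obtain ⟨eR⟩ := ih _ (by lia) R R' hR hR' rfl hRR'
    have key (L : Type v) [Fintype L] [PartialOrder L] (hL : IsNBowtieFree L)
        (hKL : ∀ m, strictPoly m (WithBot K) = strictPoly m L) : Nonempty (WithBot K ≃o L) := by
      classical
      obtain ⟨a, ⟨f⟩⟩ := exists_withBot_of_strictPoly_eq hKL
      obtain ⟨g⟩ := ih _ (by lia) K {x : L // x ≠ a} hK
        (hL.of_orderEmbedding (OrderEmbedding.subtype _)) rfl
        (strictPoly_eq_of_withBot fun m => by rw [hKL, strictPoly_congr f])
      exact ⟨g.withBotCongr.trans f⟩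
    have eT : Nonempty (T ≃o T') := by
      rcases hKT with ⟨⟨f⟩⟩ | ⟨⟨f⟩⟩
      · obtain ⟨g⟩ := key T' hT' fun m => by rw [strictPoly_congr f, hTT']
        exact ⟨f.symm.trans g⟩
      -- When `T` has a greatest element, the argument runs on the duals, whose polynomials agree
      -- after reversing the variables.
      · obtain ⟨g⟩ := key T'ᵒᵈ hT'.dual fun m => by
          rw [strictPoly_congr f, strictPoly_dual, strictPoly_dual, hTT']
        exact ⟨(f.symm.trans g).dual⟩
    obtain ⟨eT⟩ := eT
    exact ⟨e.symm.trans ((OrderIso.sumCongr eT eR).trans e')⟩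

end Reconstruction

/-! ### From weak to strict labellings. -/

section Reciprocity

open Finsupp

variable {P Q Λ Λ' : Type*}

section

variable [PartialOrder P] [LinearOrder Λ]

/-- A labelling is admissible if it is weakly order preserving, and strictly so at the labels
in `t`. -/
def IsAdmissible (t : Set Λ) (f : P → Λ) : Prop :=
  ∀ u v, u < v → f u < f v ∨ (f u = f v ∧ f u ∉ t)

theorem isAdmissible_empty_iff {f : P → Λ} :
    IsAdmissible ∅ f ↔ ∀ u v, u < v → f u ≤ f v := by
  simp [IsAdmissible, le_iff_lt_or_eq]

theorem isAdmissible_univ_iff {f : P → Λ} :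
    IsAdmissible Set.univ f ↔ ∀ u v, u < v → f u < f v := by
  simp [IsAdmissible]

end

section

variable [Fintype P]

/-- The function counting how often each value is taken by `f`. -/
noncomputable def profile (f : P → Λ) : Λ →₀ ℕ := ∑ v, single (f v) 1

theorem profile_apply (f : P → Λ) (q : Λ) : profile f q = ∑ v, single (f v) 1 q :=
  finsetSum_apply _ _ _

theorem profile_apply_ne_zero (f : P → Λ) (v : P) : profile f (f v) ≠ 0 := by
  intro h
  rw [profile_apply, Finset.sum_eq_zero_iff] at h
  simpa using h v (Finset.mem_univ v)

theorem profile_comp (f : P → Λ) (e : Λ → Λ') : profile (e ∘ f) = mapDomain e (profile f) := by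
  simp [profile, mapDomain_finsetSum]

theorem coeff_formalSum (S : Set (P → ℕ+)) (m : ℕ+ →₀ ℕ) :
    MvPowerSeries.coeff m (formalSum S) = ({f | f ∈ S ∧ profile f = m}.ncard : ℤ) := by
  classical
  have h (f : P → ℕ+) : (∏ v, MvPowerSeries.X (f v) : MvPowerSeries ℕ+ ℤ) =
      ((MvPolynomial.monomial (profile f) (1 : ℤ) : MvPolynomial ℕ+ ℤ) : MvPowerSeries ℕ+ ℤ) := by
    rw [profile, MvPolynomial.monomial_sum_one, ← MvPolynomial.coeToMvPowerSeries.ringHom_apply,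
      map_prod]
    refine Finset.prod_congr rfl fun v _ => ?_
    rw [MvPolynomial.coeToMvPowerSeries.ringHom_apply, MvPolynomial.coe_monomial, MvPowerSeries.X]
  change ∑ᶠ f ∈ S, MvPowerSeries.coeff m (∏ v, MvPowerSeries.X (f v) : MvPowerSeries ℕ+ ℤ) = _
  simp_rw [h, MvPolynomial.coeff_coe, MvPolynomial.coeff_monomial]
  have hfin : {f | f ∈ S ∧ profile f = m}.Finite := by
    refine (finite_support_coeff_prod_X P m).subset fun f hf => ?_
    rw [Function.mem_support, h, MvPolynomial.coeff_coe, MvPolynomial.coeff_monomial, if_pos hf.2]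
    exact one_ne_zero
  have hite (f : P → ℕ+) : (∑ᶠ _ : f ∈ S, if profile f = m then (1 : ℤ) else 0) =
      ∑ᶠ _ : f ∈ {f | f ∈ S ∧ profile f = m}, (1 : ℤ) := by
    by_cases h1 : f ∈ S <;> by_cases h2 : profile f = m <;> simp [h1, h2]
  simp_rw [hite]
  rw [finsum_mem_eq_finite_toFinset_sum _ hfin, Finset.sum_const, Set.ncard_eq_toFinset_card _ hfin]
  simp

end

variable [Fintype P] [PartialOrder P] [Fintype Q] [PartialOrder Q] [LinearOrder Λ] [LinearOrder Λ']

/-- The number of admissible labellings with a given profile. -/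
noncomputable def admissibleCount (P : Type*) [Fintype P] [PartialOrder P] (t : Set Λ)
    (d : Λ →₀ ℕ) : ℕ :=
  {f : P → Λ | IsAdmissible t f ∧ profile f = d}.ncard

theorem strictOrderQSym_eq_iff : strictOrderQSym P = strictOrderQSym Q ↔
    ∀ d : ℕ+ →₀ ℕ, admissibleCount P Set.univ d = admissibleCount Q Set.univ d := by
  simp only [MvPowerSeries.ext_iff, strictOrderQSym, coeff_formalSum, admissibleCount,
    isAdmissible_univ_iff, Set.mem_ofPred_eq, Nat.cast_inj]

theorem weakOrderQSym_eq_iff : weakOrderQSym P = weakOrderQSym Q ↔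
    ∀ d : ℕ+ →₀ ℕ, admissibleCount P ∅ d = admissibleCount Q ∅ d := by
  simp only [MvPowerSeries.ext_iff, weakOrderQSym, coeff_formalSum, admissibleCount,
    isAdmissible_empty_iff, Set.mem_ofPred_eq, Nat.cast_inj]

theorem strictPoly_eq_iff {m : ℕ} : strictPoly m P = strictPoly m Q ↔
    ∀ d : Fin m →₀ ℕ, admissibleCount P Set.univ d = admissibleCount Q Set.univ d := by
  simp only [MvPolynomial.ext_iff, coeff_strictPoly, admissibleCount, profile,
    isAdmissible_univ_iff, StrictMono, Nat.cast_inj]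

theorem admissibleCount_congr (e : P ≃o Q) (t : Set Λ) (d : Λ →₀ ℕ) :
    admissibleCount P t d = admissibleCount Q t d := by
  refine Set.ncard_congr (fun f _ => f ∘ e.symm) ?_ ?_ ?_
  · rintro f ⟨hf, rfl⟩
    refine ⟨fun u v huv => hf _ _ (e.symm.strictMono huv), ?_⟩
    exact Fintype.sum_equiv e.symm.toEquiv _ _ fun v => rfl
  · intro f g _ _ hfg
    exact e.symm.surjective.injective_comp_right hfg
  · rintro g ⟨hg, rfl⟩
    refine ⟨g ∘ e, ⟨fun u v huv => hg _ _ (e.strictMono huv), ?_⟩, ?_⟩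
    · exact Fintype.sum_equiv e.toEquiv _ _ fun v => rfl
    · ext; simp

/-- The profile confines all values to the range of `e`, so every labelling counted factors through
`e`. -/
theorem admissibleCount_mapDomain (e : Λ ↪o Λ') (t : Set Λ') (d : Λ →₀ ℕ) :
    admissibleCount P t (mapDomain e d) = admissibleCount P (e ⁻¹' t) d := by
  symm
  refine Set.ncard_congr (fun f _ => e ∘ f) ?_ ?_ ?_
  · rintro f ⟨hf, rfl⟩
    refine ⟨fun u v huv => ?_, profile_comp _ _⟩
    simpa using hf u v huv
  · intro f g _ _ hfg
    exact e.injective.comp_left hfg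
  · rintro g ⟨hg, hd⟩
    have hr (v : P) : ∃ q, e q = g v := by
      classical
      have := mapDomain_support (mem_support_iff.2 (hd ▸ profile_apply_ne_zero g v))
      obtain ⟨q, -, hq⟩ := Finset.mem_image.1 this
      exact ⟨q, hq⟩
    choose f hf using hr
    obtain rfl : e ∘ f = g := funext hf
    refine ⟨f, ⟨fun u v huv => by simpa using hg u v huv, ?_⟩, rfl⟩
    exact mapDomain_injective e.injective (by rw [← profile_comp, hd])

theorem exists_mapDomain_fin (d : Λ →₀ ℕ) :
    ∃ (k : ℕ) (e : Fin k ↪o Λ) (d' : Fin k →₀ ℕ), mapDomain e d' = d := by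
  refine ⟨_, d.support.orderEmbOfFin rfl, d.comapDomain _ (d.support.orderEmbOfFin rfl).injective.injOn,
    mapDomain_comapDomain _ (d.support.orderEmbOfFin rfl).injective _ ?_⟩
  rw [Finset.range_orderEmbOfFin]

/-- Equality of the numbers of weakly or strictly order preserving labellings does not depend on
the infinite set of labels. -/
theorem admissibleCount_eq_transfer [NoMaxOrder Λ] [Nonempty Λ] (b : Prop)
    (h : ∀ d : Λ →₀ ℕ, admissibleCount P {_x | b} d = admissibleCount Q {_x | b} d)
    (d : Λ' →₀ ℕ) : admissibleCount P {_x | b} d = admissibleCount Q {_x | b} d := by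
  obtain ⟨k, e, d, rfl⟩ := exists_mapDomain_fin d
  obtain ⟨g, hg⟩ := Nat.exists_strictMono Λ
  let e' : Fin k ↪o Λ := Fin.valOrderEmb k |>.trans (OrderEmbedding.ofStrictMono g hg)
  have := h (mapDomain e' d)
  rw [admissibleCount_mapDomain, admissibleCount_mapDomain] at this ⊢
  exact this

theorem admissibleCount_congr_set {t t' : Set Λ} {d : Λ →₀ ℕ}
    (h : ∀ q, d q ≠ 0 → (q ∈ t ↔ q ∈ t')) : admissibleCount P t d = admissibleCount P t' d := by
  refine congrArg Set.ncard (Set.ext fun f => and_congr_left ?_)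
  rintro rfl
  simp only [IsAdmissible, h _ (profile_apply_ne_zero f _)]

/-! ### The sign-reversing involution. -/

section Toggle

variable {a b : Λ} {t : Set Λ} {d : Λ →₀ ℕ} {n : ℕ}

/-- Identify the label `b` with `a`. -/
def collapse (a b : Λ) (q : Λ) : Λ := if q = b then a else q

theorem profile_collapse_eq_iff {R : Type*} [Fintype R] (hab : a < b) (hd : ∀ q, a ≤ q → q ≤ b → d q = 0) (f : R → Λ) :
    profile (collapse a b ∘ f) = d + single a n ↔
      profile f a ≤ n ∧ profile f = d + single a (profile f a) + single b (n - profile f a) := by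
  constructor
  · intro h
    have ha : profile f a + profile f b = n := by
      have := DFunLike.congr_fun h a
      rw [Finsupp.add_apply, hd a le_rfl hab.le, single_eq_same, zero_add] at this
      rw [← this, profile_apply, profile_apply, profile_apply, ← Finset.sum_add_distrib]
      refine Finset.sum_congr rfl fun v _ => ?_
      simp only [Function.comp, collapse, single_apply]
      grind
    refine ⟨by lia, Finsupp.ext fun q => ?_⟩
    rcases eq_or_ne q a with rfl | hqa
    · simp [hd q le_rfl hab.le, hab.ne']
    rcases eq_or_ne q b with rfl | hqb
    · simp [hd q hab.le le_rfl, hab.ne]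
      lia
    · have := DFunLike.congr_fun h q
      simp only [Finsupp.add_apply, single_eq_of_ne hqa, single_eq_of_ne hqb, add_zero] at this ⊢
      rw [← this, profile_apply, profile_apply]
      refine Finset.sum_congr rfl fun v _ => ?_
      simp only [Function.comp, collapse, single_apply]
      grind
  · rintro ⟨hle, h⟩
    rw [profile_comp, h, mapDomain_add, mapDomain_add, mapDomain_single, mapDomain_single]
    have hd' : mapDomain (collapse a b) d = d := by
      conv_rhs => rw [← mapDomain_id (v := d)]
      refine mapDomain_congr fun q hq => ?_
      rw [collapse, if_neg, id]
      rintro rfl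
      exact mem_support_iff.1 hq (hd q hab.le le_rfl)
    rw [hd', add_assoc, collapse, collapse, if_neg hab.ne, if_pos rfl, ← single_add]
    congr 2
    lia

/-- Elements below `v₀` have labels below `a`, so they are unaffected. Above `v₀`, a strict `a`
forces labels at least `b`, exactly what a weak `b` allows, so the two labels are interchangeable at
`v₀`. -/
theorem isAdmissible_update {R : Type*} [PartialOrder R] [DecidableEq R] (hab : a < b) (ha : a ∈ t) (hb : b ∉ t) {f : R → Λ}
    (hf : IsAdmissible t f) (hout : ∀ v, f v = a ∨ f v = b ∨ f v < a ∨ b < f v) {v₀ : R}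
    (hv₀ : f v₀ = a ∨ f v₀ = b) (hmin : ∀ u < v₀, f u ≠ a ∧ f u ≠ b) :
    IsAdmissible t (Function.update f v₀ (Equiv.swap a b (f v₀))) := by
  have hswap : (f v₀ = a ∧ Equiv.swap a b (f v₀) = b) ∨
      (f v₀ = b ∧ Equiv.swap a b (f v₀) = a) := by
    rcases hv₀ with h | h <;> simp [h]
  intro u v huv
  have h1 := hf u v huv
  have hu := hout u
  have hv := hout v
  by_cases huv₀ : u = v₀
  · subst huv₀
    rw [Function.update_self, Function.update_of_ne huv.ne']
    grind
  · rw [Function.update_of_ne huv₀]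
    by_cases hvv₀ : v = v₀
    · subst hvv₀
      rw [Function.update_self]
      have := hmin u huv
      grind
    · rw [Function.update_of_ne hvv₀]
      exact h1

/-- Merging a strict label `a` with the next label `b`, which is weak, the signed number of
labellings vanishes. -/
theorem sum_admissibleCount_eq_zero (hab : a < b) (ha : a ∈ t) (hb : b ∉ t)
    (hd : ∀ q, a ≤ q → q ≤ b → d q = 0) (hn : n ≠ 0) :
    ∑ k ∈ Finset.range (n + 1), (-1) ^ k *
      (admissibleCount P t (d + single a k + single b (n - k)) : ℤ) = 0 := by
  classical
  let S : Set (P → Λ) := {f | IsAdmissible t f ∧ profile (collapse a b ∘ f) = d + single a n}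
  have hvals (f : P → Λ) (hf : profile (collapse a b ∘ f) = d + single a n) (v : P) :
      f v = a ∨ f v = b ∨ d (f v) ≠ 0 := by
    have := profile_apply_ne_zero (collapse a b ∘ f) v
    rw [hf] at this
    simp only [Function.comp, collapse, Finsupp.add_apply, single_apply] at this
    grind
  have hS : S.Finite := by
    refine (Set.Finite.pi' fun _ : P => (insert a (insert b d.support)).finite_toSet).subset ?_
    intro f hf v
    simpa using hvals f hf.2 v
  let F := hS.toFinset
  have hcount (k : ℕ) (hk : k ∈ Finset.range (n + 1)) :
      admissibleCount P t (d + single a k + single b (n - k)) =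
        (F.filter fun f => profile f a = k).card := by
    rw [admissibleCount, ← Set.ncard_coe_finset]
    congr 1
    ext f
    simp only [Finset.coe_filter, Set.mem_ofPred_eq, F, Set.Finite.mem_toFinset, S,
      profile_collapse_eq_iff hab hd]
    constructor
    · rintro ⟨h1, h2⟩
      have : profile f a = k := by
        simp [h2, hd a le_rfl hab.le, hab.ne']
      rw [this]
      exact ⟨⟨h1, Nat.lt_succ_iff.1 (Finset.mem_range.1 hk), h2⟩, rfl⟩
    · rintro ⟨⟨h1, -, h2⟩, rfl⟩
      exact ⟨h1, h2⟩
  have hfib : ∑ k ∈ Finset.range (n + 1), (-1) ^ k *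
      (admissibleCount P t (d + single a k + single b (n - k)) : ℤ) =
      ∑ f ∈ F, (-1) ^ profile f a := by
    rw [← Finset.sum_fiberwise_of_maps_to (t := Finset.range (n + 1)) (g := fun f => profile f a)]
    · refine Finset.sum_congr rfl fun k hk => ?_
      rw [hcount k hk, Finset.sum_congr rfl fun f hf => by rw [(Finset.mem_filter.1 hf).2],
        Finset.sum_const, nsmul_eq_mul, mul_comm]
    · intro f hf
      have := ((profile_collapse_eq_iff hab hd f).1 ((Set.Finite.mem_toFinset _).1 hf).2).1
      exact Finset.mem_range.2 (Nat.lt_succ_of_le this)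
  have hsign (f : P → Λ) : (-1 : ℤ) ^ profile f a = ∏ v, if f v = a then (-1 : ℤ) else 1 := by
    rw [profile_apply, ← Finset.prod_pow_eq_pow_sum]
    refine Finset.prod_congr rfl fun v _ => ?_
    rw [single_apply]
    split_ifs <;> simp
  let K (f : P → Λ) : Set P := {v | collapse a b (f v) = a}
  have hK (f : P → Λ) (v : P) : v ∈ K f ↔ f v = a ∨ f v = b := by
    simp only [K, Set.mem_ofPred_eq, collapse]
    grind
  have hKne (f) (hf : f ∈ F) : (K f).Nonempty := by
    have h2 := ((Set.Finite.mem_toFinset _).1 hf).2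
    by_contra hne
    rw [Set.not_nonempty_iff_eq_empty, Set.eq_empty_iff_forall_notMem] at hne
    have := DFunLike.congr_fun h2 a
    rw [profile_apply, Finset.sum_eq_zero fun v _ => by rw [single_apply, if_neg]; exact hne v] at this
    simp at this
    lia
  rw [hfib]
  rcases F.eq_empty_or_nonempty with hF | ⟨f₀, hf₀⟩
  · rw [hF, Finset.sum_empty]
  have : Nonempty P := (hKne f₀ hf₀).to_type
  -- The toggled element is chosen from the set `K f` alone, not from `f`. Toggling preserves this
  -- set, so doing it twice is the identity.
  have hchoice (K : Set P) : ∃ v, K.Nonempty → Minimal (· ∈ K) v := by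
    by_cases hK : K.Nonempty
    · obtain ⟨v, hv⟩ := K.toFinite.exists_minimal hK
      exact ⟨v, fun _ => hv⟩
    · exact ⟨Classical.arbitrary P, fun h => absurd h hK⟩
  choose μ hμ using hchoice
  let τ (f : P → Λ) : P → Λ := Function.update f (μ (K f)) (Equiv.swap a b (f (μ (K f))))
  have hcol (f) (hf : f ∈ F) : collapse a b ∘ τ f = collapse a b ∘ f := by
    have h1 := (hK _ _).1 (hμ _ (hKne f hf)).1
    ext v
    simp only [Function.comp, τ, Function.update_apply, collapse]
    split_ifs with h <;> grind [Equiv.swap_apply_left, Equiv.swap_apply_right]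
  have hKτ (f) (hf : f ∈ F) : K (τ f) = K f := by
    ext v
    exact Eq.congr_left (congrFun (hcol f hf) v)
  refine Finset.sum_involution (fun f _ => τ f) ?_ ?_ ?_ ?_
  · intro f hf
    have h1 := (hK _ _).1 (hμ _ (hKne f hf)).1
    rw [hsign, hsign, ← Finset.mul_prod_erase _ _ (Finset.mem_univ (μ (K f))),
      ← Finset.mul_prod_erase Finset.univ (fun v => if τ f v = a then (-1 : ℤ) else 1)
        (Finset.mem_univ (μ (K f)))]
    have hrest : ∏ v ∈ Finset.univ.erase (μ (K f)), (if τ f v = a then (-1 : ℤ) else 1) =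
        ∏ v ∈ Finset.univ.erase (μ (K f)), if f v = a then (-1 : ℤ) else 1 :=
      Finset.prod_congr rfl fun v hv => by
        rw [show τ f v = f v from Function.update_of_ne (Finset.ne_of_mem_erase hv) _ _]
    rw [hrest, ← add_mul]
    refine mul_eq_zero_of_left ?_ _
    simp only [τ, Function.update_self]
    rcases h1 with h1 | h1 <;> simp [h1, hab.ne']
  · intro f hf _ h
    have h1 := (hK _ _).1 (hμ _ (hKne f hf)).1
    have := congrFun h (μ (K f))
    simp only [τ, Function.update_self] at this
    rcases h1 with h1 | h1 <;> simp [h1, hab.ne, hab.ne'] at this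
  · intro f hf
    obtain ⟨h1, h2⟩ := (Set.Finite.mem_toFinset _).1 hf
    refine (Set.Finite.mem_toFinset _).2 ⟨?_, by rw [hcol f hf, h2]⟩
    have hmin := hμ _ (hKne f hf)
    refine isAdmissible_update hab ha hb h1 (fun v => ?_) ((hK _ _).1 hmin.1) fun u hu => ?_
    · have := hvals f h2 v
      have := hd (f v)
      grind
    · have := fun h => hmin.not_lt h hu
      rw [hK] at this
      tauto
  · intro f hf
    have := hKτ f hf
    ext v
    simp only [τ] at this ⊢
    rw [this]
    by_cases hv : v = μ (K f)
    · subst hv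
      simp
    · simp [hv]

end Toggle

theorem exists_gt_forall_lt [DenselyOrdered Λ] [NoMaxOrder Λ] (a : Λ) (s : Finset Λ) :
    ∃ b, a < b ∧ ∀ q ∈ s, a < q → b < q := by
  induction s using Finset.induction_on with
  | empty => simpa using exists_gt a
  | insert c s _ ih =>
    obtain ⟨b, hab, hb⟩ := ih
    by_cases hac : a < c
    · obtain ⟨e, hae, he⟩ := exists_between (lt_min hab hac)
      refine ⟨e, hae, fun q hq haq => ?_⟩
      rcases Finset.mem_insert.1 hq with rfl | hq
      · exact he.trans_le (min_le_right _ _)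
      · exact (he.trans_le (min_le_left _ _)).trans (hb q hq haq)
    · refine ⟨b, hab, fun q hq haq => ?_⟩
      rcases Finset.mem_insert.1 hq with rfl | hq
      · exact absurd haq hac
      · exact hb q hq haq

open Classical in
/-- The numbers of weakly order preserving labellings determine the numbers of admissible
labellings for all sets of strict labels. -/
theorem admissibleCount_eq_of_weak [DenselyOrdered Λ] [NoMaxOrder Λ]
    (h : ∀ d : Λ →₀ ℕ, admissibleCount P ∅ d = admissibleCount Q ∅ d) (w : ℕ) :
    ∀ (t : Set Λ) (d : Λ →₀ ℕ), (d.sum fun q k => if q ∈ t then k else 0) = w →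
      admissibleCount P t d = admissibleCount Q t d := by
  induction w using Nat.strong_induction_on with
  | _ w ih =>
  intro t d hw
  by_cases hex : ∃ a ∈ t, d a ≠ 0
  · obtain ⟨a, hat, hda⟩ := hex
    -- Density provides an unused label `b` just after `a`, with no used label in between. Being
    -- unused, it may be declared weak by passing to `t \ {b}`.
    obtain ⟨b, hab, hb⟩ := exists_gt_forall_lt a d.support
    have hdb (q : Λ) (haq : a < q) (hqb : q ≤ b) : d q = 0 := by
      by_contra hq
      exact absurd (hb q (mem_support_iff.2 hq) haq) hqb.not_gt
    have hset (q : Λ) (hq : d q ≠ 0) : q ∈ t ↔ q ∈ t \ {b} := by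
      have : q ≠ b := by
        rintro rfl
        exact hq (hdb q hab le_rfl)
      simp [this]
    have hdec : d.erase a + single a (d a) = d := erase_add_single a d
    have hd0 (q : Λ) (haq : a ≤ q) (hqb : q ≤ b) : d.erase a q = 0 := by
      rcases haq.eq_or_lt with rfl | haq
      · simp
      · rw [erase_ne haq.ne', hdb q haq hqb]
    have hat' : a ∈ t \ {b} := ⟨hat, hab.ne⟩
    have hbt : b ∉ t \ {b} := fun hb => hb.2 rfl
    have hsum (k : ℕ) : ((d.erase a + single a k + single b (d a - k)).sum fun q k =>
        if q ∈ t \ {b} then k else 0) =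
        ((d.erase a).sum fun q k => if q ∈ t \ {b} then k else 0) + k := by
      rw [sum_add_index', sum_add_index', sum_single_index, sum_single_index, if_pos hat',
        if_neg hbt, add_zero]
      all_goals intros; split_ifs <;> simp
    have hw' : ((d.erase a).sum fun q k => if q ∈ t \ {b} then k else 0) + d a = w := by
      rw [← hsum, Nat.sub_self, single_zero, add_zero, hdec, ← hw]
      exact Finset.sum_congr rfl fun q hq => by simp only [← hset q (mem_support_iff.1 hq)]
    have hP := sum_admissibleCount_eq_zero (P := P) hab hat' hbt hd0 hda
    have hQ := sum_admissibleCount_eq_zero (P := Q) hab hat' hbt hd0 hda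
    -- The top term `k = d a` is the original count. The others keep only `k < d a` elements at the
    -- strict label `a`, so the induction on the multiplicity at strict labels covers them.
    rw [Finset.sum_range_succ, Nat.sub_self, single_zero, add_zero, hdec] at hP hQ
    rw [admissibleCount_congr_set hset, admissibleCount_congr_set hset]
    have hih (k : ℕ) (hk : k ∈ Finset.range (d a)) :
        admissibleCount P (t \ {b}) (d.erase a + single a k + single b (d a - k)) =
          admissibleCount Q (t \ {b}) (d.erase a + single a k + single b (d a - k)) := by
      refine ih _ ?_ _ _ (Eq.trans (by congr!) (hsum k))
      have := Finset.mem_range.1 hk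
      lia
    rw [Finset.sum_congr rfl fun k hk => by rw [hih k hk], ← hQ] at hP
    exact_mod_cast mul_left_cancel₀ (pow_ne_zero _ (by norm_num)) (add_left_cancel hP)
  · push Not at hex
    rw [admissibleCount_congr_set (P := P) (t' := ∅), admissibleCount_congr_set (P := Q) (t' := ∅), h]
    all_goals exact fun q hq => by simpa using fun hqt => hq (hex q hqt)

/-- Inserting fresh labels needs a dense order, so the comparison is carried out over `ℚ` and
transferred back to `ℕ+`. -/
theorem strictOrderQSym_eq_of_weakOrderQSym_eq (h : weakOrderQSym P = weakOrderQSym Q) :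
    strictOrderQSym P = strictOrderQSym Q := by
  have hweak : ∀ d : ℚ →₀ ℕ, admissibleCount P ∅ d = admissibleCount Q ∅ d :=
    admissibleCount_eq_transfer False (weakOrderQSym_eq_iff.1 h)
  exact strictOrderQSym_eq_iff.2 (admissibleCount_eq_transfer True fun d : ℚ →₀ ℕ =>
    admissibleCount_eq_of_weak hweak _ _ d rfl)

theorem strictPoly_eq_of_strictOrderQSym_eq (h : strictOrderQSym P = strictOrderQSym Q) (m : ℕ) :
    strictPoly m P = strictPoly m Q :=
  strictPoly_eq_iff.2 (admissibleCount_eq_transfer True (strictOrderQSym_eq_iff.1 h))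

end Reciprocity

theorem theorem5p1 {P : Type*} {Q : Type*} [Fintype P] [PartialOrder P] [Fintype Q]
    [PartialOrder Q] (hP : IsNBowtieFree P) (hQ : IsNBowtieFree Q) :
    List.TFAE
      [strictOrderQSym P = strictOrderQSym Q,
       weakOrderQSym P = weakOrderQSym Q,
       Nonempty (P ≃o Q)] := by
  tfae_have 1 → 3 := fun h =>
    IsNBowtieFree.nonempty_orderIso _ P Q hP hQ rfl (strictPoly_eq_of_strictOrderQSym_eq h)
  tfae_have 3 → 2 := fun ⟨e⟩ => weakOrderQSym_eq_iff.2 fun d => admissibleCount_congr e ∅ d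
  tfae_have 2 → 1 := strictOrderQSym_eq_of_weakOrderQSym_eq
  tfae_finish
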